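/- A (Clifford) ZX diagram $D$ is a finite multigraph (parallel edges and loops allowed) each of whose vertices is a Z-spider or an X-spider with a phase $k\pi/2$, a Hadamard box (of degree $2$) or a boundary vertex (of degree $1$). Its interpretation $[\![D]\!]$ is the linear map (equivalently, the tensor on the boundary qubits) obtained by contracting, along the edges, the Z-spiders $|0\cdots0\rangle+e^{ik\pi/2}|1\cdots1\rangle$, the X-spiders $|{+}\cdots{+}\rangle+e^{ik\pi/2}|{-}\cdots{-}\rangle$ and the Hadamard matrices. Interpretations are compared up to a nonzero scalar, and $\sim$ denotes equality up to a nonzero scalar. An error $\mathcal E$ on $D$ is a set of pairs $(e,t)$ of an edge $e$ of $D$ and a type $t\in\{X,Z\}$; its weight is the number of edges $e$ that occur in it, and $D+\mathcal E$ is the diagram obtained from $D$ by inserting, for every $(e,t)\in\mathcal E$, a two-legged spider of colour $t$ with phase $\pi$ (the Pauli matrix $t$) on the edge $e$. The ZX distance $d(D)\in\mathbb N\cup\{\infty\}$ is the minimum weight of an error $\mathcal E$ with $[\![D+\mathcal E]\!]\not\sim[\![D]\!]$ and $[\![D+\mathcal E]\!]\neq 0$ ($\infty$ if there is none). Let $D_1,D_2$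 be diagrams with the same boundary. The rewrite $D_1\to D_2$ is distance non-decreasing if $[\![D_1]\!]\sim[\![D_2]\!]$ and, for every diagram $D$ in which $D_1$ occurs, the diagram $D'$ obtained from $D$ by replacing this occurrence of $D_1$ by $D_2$ satisfies $d(D)\le d(D')$. It is distance-preserving if both $D_1\to D_2$ and $D_2\to D_1$ are distance non-decreasing. **Theorem.** Let $n$ be even. Let $D_1$ be the $n$-legged Z-spider with phase $0$, and let $D_2$ be the diagram with $n$ boundary legs that consists of two inner Z-spiders with $n/2$ legs each and $n/2$ outer Z-spiders with four legs each, all with phase $0$, where each outer spider is joined by one internal edge to each of the two inner spiders and carries two of the $n$ boundary legs. Then the rewrite $D_1\to D_2$ is distance-preserving. -/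

import Mathlib

/-!
Clifford ZX diagrams as finite open multigraphs, their interpretation, edge-flip errors, the ZX
distance, and distance-preserving rewrites.
-/

namespace ZX

/-- The types of non-boundary vertices: a Z-spider or an X-spider with phase `k * π / 2`
(so that `exp (i k π / 2) = I ^ k`), or a Hadamard box. -/
inductive Node where
  | Z (k : Fin 4)
  | X (k : Fin 4)
  | H

/-- The coefficient of a vertex, with set of legs `L`, at the computational basis labels `x` of its
legs.
* Z-spider: `|0…0⟩ + I ^ k |1…1⟩`.
* X-spider: `|+…+⟩ + I ^ k |-…-⟩`.
* Hadamard box (only used with two legs): the matrix `(1/√2) [[1, 1], [1, -1]]`. -/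
noncomputable def Node.coeff {L : Type} [Fintype L] : Node → (L → Fin 2) → ℂ
  | .Z k, x => (∏ l, if x l = 0 then 1 else 0) + Complex.I ^ (k : ℕ) * ∏ l, if x l = 1 then 1 else 0
  | .X k, x => (∏ _l : L, 1 / (Real.sqrt 2 : ℂ)) +
      Complex.I ^ (k : ℕ) * ∏ l, (if x l = 0 then 1 else -1) / (Real.sqrt 2 : ℂ)
  | .H, x => (if ∀ l, x l = 1 then -1 else 1) / (Real.sqrt 2 : ℂ)

/-- A ZX diagram with set of boundary vertices `B`: a finite multigraph (parallel edges and loops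
are allowed) with vertex set `V ⊕ B`. An edge `e` has the two ends `(e, 0)` and `(e, 1)`; which one
is called `0` is immaterial. Hadamard boxes have degree two and boundary vertices degree one. -/
structure Diagram (B : Type) where
  V : Type
  E : Type
  [fintypeV : Fintype V]
  [fintypeE : Fintype E]
  node : V → Node
  ends : E × Fin 2 → V ⊕ B
  hadamard_degree : ∀ v, node v = Node.H → Nat.card {h : E × Fin 2 // ends h = Sum.inl v} = 2
  boundary_degree : ∀ b, ∃! h : E × Fin 2, ends h = Sum.inr b

attribute [instance] Diagram.fintypeV Diagram.fintypeE

/-- The two types of edge flips. -/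
inductive Flip where
  | X
  | Z

/-- A flip is the two-legged spider of its colour with phase `π`. -/
def Flip.node : Flip → Node
  | .X => Node.X 2
  | .Z => Node.Z 2

/-- The two-legged spider of a flip, as a matrix (the Pauli matrix `X` or `Z`). -/
noncomputable def Flip.matrix (t : Flip) : Matrix (Fin 2) (Fin 2) ℂ :=
  Matrix.of fun a b => t.node.coeff ![a, b]

namespace Diagram

variable {B : Type}

/-- An error is a set of edge flips. -/
abbrev Error (D : Diagram B) : Type := Finset (D.E × Flip)

open Classical in
/-- The weight of an error is the number of edges it affects. -/
noncomputable def weight (D : Diagram B) (ε : D.Error) : ℕ := (ε.image Prod.fst).card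

open Classical in
/-- The matrix on the edge `e` of `D + ε`: the flips of `ε` on `e`, composed. (The order of the two
flips only matters for the sign.) -/
noncomputable def edgeMatrix (D : Diagram B) (ε : D.Error) (e : D.E) : Matrix (Fin 2) (Fin 2) ℂ :=
  (if (e, Flip.X) ∈ ε then Flip.X.matrix else 1) * (if (e, Flip.Z) ∈ ε then Flip.Z.matrix else 1)

open Classical in
/-- The interpretation of `D + ε`, i.e. of `D` with the flips of `ε` inserted on its edges, as a
tensor on the boundary qubits: its coefficient at the labels `y` of the boundary is the sum, over
all labellings `x` of the ends of the edges that restrict to `y` on the boundary, of the product of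
the coefficients of all edges and vertices. Reading some boundary vertices as inputs and the others
as outputs, these are the matrix entries of the linear map of the diagram. -/
noncomputable def interpError (D : Diagram B) (ε : D.Error) (y : B → Fin 2) : ℂ :=
  ∑ x : D.E × Fin 2 → Fin 2,
    if ∀ h b, D.ends h = Sum.inr b → x h = y b then
      (∏ e, D.edgeMatrix ε e (x (e, 0)) (x (e, 1))) *
        ∏ v, (D.node v).coeff (fun h : {h : D.E × Fin 2 // D.ends h = Sum.inl v} => x h)
    else 0

/-- The interpretation of a diagram. -/
noncomputable def interp (D : Diagram B) : (B → Fin 2) → ℂ := D.interpError ∅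

end Diagram

/-- Equality of interpretations, up to a nonzero scalar. -/
def SameUpToScalar {Y : Type} (f g : Y → ℂ) : Prop := ∃ c : ℂ, c ≠ 0 ∧ f = c • g

namespace Diagram

variable {B : Type}

/-- An error is trivial if it does not change the interpretation. -/
def IsTrivial (D : Diagram B) (ε : D.Error) : Prop := SameUpToScalar (D.interpError ε) D.interp

/-- An error is detectable if it makes the interpretation zero. -/
def IsDetectable (D : Diagram B) (ε : D.Error) : Prop := D.interpError ε = 0

/-- The ZX distance: the minimum weight of the non-trivial undetectable errors (`⊤` if there are
none). -/
noncomputable def distance (D : Diagram B) : ℕ∞ :=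
  ⨅ (ε : D.Error) (_ : ¬ D.IsTrivial ε) (_ : ¬ D.IsDetectable ε), (D.weight ε : ℕ∞)

end Diagram

/-- A diagram with set of boundary vertices `P` in which every boundary edge has its other end at
a non-boundary vertex: `E` is the set of internal edges, and the boundary edge at `p : P` joins `p`
to the vertex `leg p`. Both sides of a rewrite are given in this form. -/
structure Pattern (P : Type) where
  V : Type
  E : Type
  [fintypeV : Fintype V]
  [fintypeE : Fintype E]
  node : V → Node
  ends : E × Fin 2 → V
  leg : P → V
  hadamard_degree : ∀ v, node v = Node.H →
    Nat.card {h : E × Fin 2 // ends h = v} + Nat.card {p : P // leg p = v} = 2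

attribute [instance] Pattern.fintypeV Pattern.fintypeE

namespace Pattern

variable {P : Type}

/-- The ends of the edges of the diagram of a pattern. -/
def diagramEnds (D : Pattern P) : (D.E ⊕ P) × Fin 2 → D.V ⊕ P
  | (.inl e, i) => .inl (D.ends (e, i))
  | (.inr p, 0) => .inl (D.leg p)
  | (.inr p, 1) => .inr p

theorem card_diagramEnds [Fintype P] (D : Pattern P) (v : D.V) :
    Nat.card {h // D.diagramEnds h = Sum.inl v} =
      Nat.card {h : D.E × Fin 2 // D.ends h = v} + Nat.card {p : P // D.leg p = v} := by
  rw [← Nat.card_sum]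
  refine (Nat.card_congr (Equiv.ofBijective
    (Sum.elim (fun h => ⟨(.inl h.1.1, h.1.2), congrArg Sum.inl h.2⟩)
      (fun p => ⟨(.inr p.1, 0), congrArg Sum.inl p.2⟩)) ⟨?_, ?_⟩)).symm
  · rintro (⟨⟨e, i⟩, h⟩ | ⟨p, h⟩) (⟨⟨e', i'⟩, h'⟩ | ⟨p', h'⟩) hh <;>
      replace hh := congrArg Subtype.val hh <;> simp_all
  · rintro ⟨⟨e | p, i⟩, h⟩
    · exact ⟨.inl ⟨(e, i), Sum.inl.inj h⟩, rfl⟩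
    · fin_cases i
      · exact ⟨.inr ⟨p, Sum.inl.inj h⟩, rfl⟩
      · exact (Sum.inr_ne_inl h).elim

/-- The diagram of a pattern, with its internal edges and its boundary edges. -/
def toDiagram [Fintype P] (D : Pattern P) : Diagram P where
  V := D.V
  E := D.E ⊕ P
  node := D.node
  ends := D.diagramEnds
  hadamard_degree v hv := (D.card_diagramEnds v).trans (D.hadamard_degree v hv)
  boundary_degree p := by
    refine ⟨(.inr p, 1), rfl, ?_⟩
    rintro ⟨e | q, i⟩ h
    · exact (Sum.inl_ne_inr h).elim
    · fin_cases i
      · exact (Sum.inl_ne_inr h).elim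
      · obtain rfl : q = p := Sum.inr.inj h
        rfl

end Pattern

namespace Diagram

variable {B P : Type}

/-- The new position of an end when a pattern is put into a context: an end at the port `p` moves
to the vertex of the pattern that carries the leg `p`. -/
def plugEnd (C : Diagram (B ⊕ P)) (D : Pattern P) :
    C.V ⊕ (B ⊕ P) → (C.V ⊕ D.V) ⊕ B
  | .inl v => .inl (.inl v)
  | .inr (.inl b) => .inr b
  | .inr (.inr p) => .inl (.inr (D.leg p))

/-- The ends of the edges after a pattern is put into a context. -/
def plugEnds (C : Diagram (B ⊕ P)) (D : Pattern P) :
    (C.E ⊕ D.E) × Fin 2 → (C.V ⊕ D.V) ⊕ B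
  | (.inl e, i) => C.plugEnd D (C.ends (e, i))
  | (.inr e, i) => .inl (.inr (D.ends (e, i)))

theorem card_plugEnds_inl (C : Diagram (B ⊕ P)) (D : Pattern P) (v : C.V) :
    Nat.card {h // C.plugEnds D h = Sum.inl (Sum.inl v)} =
      Nat.card {h // C.ends h = Sum.inl v} := by
  refine (Nat.card_congr (Equiv.ofBijective
    (fun h => ⟨(.inl h.1.1, h.1.2), congrArg (C.plugEnd D) h.2⟩) ⟨?_, ?_⟩)).symm
  · rintro ⟨⟨e, i⟩, h⟩ ⟨⟨e', i'⟩, h'⟩ hh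
    replace hh := congrArg Subtype.val hh
    simp_all
  · rintro ⟨⟨e | e, i⟩, h⟩
    · refine ⟨⟨(e, i), ?_⟩, rfl⟩
      rcases hx : C.ends (e, i) with w | b | p <;> simp_all [plugEnds, plugEnd]
    · simp [plugEnds] at h

theorem card_plugEnds_inr (C : Diagram (B ⊕ P)) (D : Pattern P) (v : D.V) :
    Nat.card {h // C.plugEnds D h = Sum.inl (Sum.inr v)} =
      Nat.card {h : D.E × Fin 2 // D.ends h = v} + Nat.card {p : P // D.leg p = v} := by
  choose port hport huniq using fun p : P => C.boundary_degree (Sum.inr p)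
  have hfin : Finite P := Finite.of_injective port fun p q hpq => by
    have h := hport p
    simp only [hpq] at h
    exact (Sum.inr.inj (Sum.inr.inj ((hport q).symm.trans h))).symm
  have hleg : ∀ p w, D.leg p = w →
      C.plugEnds D (.inl (port p).1, (port p).2) = Sum.inl (Sum.inr w) := fun p w hp =>
    (congrArg (C.plugEnd D) (hport p)).trans (congrArg (fun w => Sum.inl (Sum.inr w)) hp)
  rw [← Nat.card_sum]
  refine (Nat.card_congr (Equiv.ofBijective
    (Sum.elim (fun h => ⟨(.inr h.1.1, h.1.2), congrArg (fun w => Sum.inl (Sum.inr w)) h.2⟩)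
      (fun p => ⟨(.inl (port p.1).1, (port p.1).2), hleg p.1 v p.2⟩)) ⟨?_, ?_⟩)).symm
  · rintro (⟨⟨e, i⟩, h⟩ | ⟨p, h⟩) (⟨⟨e', i'⟩, h'⟩ | ⟨p', h'⟩) hh <;>
      replace hh := congrArg Subtype.val hh
    · simp_all
    · simp at hh
    · simp at hh
    · have hpq : port p = port p' := by
        simp only [Sum.elim_inr, Prod.mk.injEq, Sum.inl.injEq] at hh
        exact Prod.ext hh.1 hh.2
      have h1 := hport p
      simp only [hpq] at h1
      obtain rfl := Sum.inr.inj (Sum.inr.inj ((hport p').symm.trans h1))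
      rfl
  · rintro ⟨⟨e | e, i⟩, h⟩
    · rcases hx : C.ends (e, i) with w | b | p
      · simp [plugEnds, plugEnd, hx] at h
      · simp [plugEnds, plugEnd, hx] at h
      · have hp : D.leg p = v := by simpa [plugEnds, plugEnd, hx] using h
        have := huniq p (e, i) hx
        refine ⟨.inr ⟨p, hp⟩, ?_⟩
        simp [← this]
    · exact ⟨.inl ⟨(e, i), by simpa [plugEnds] using h⟩, rfl⟩

/-- The diagram in which the pattern `D` occurs in the context `C`. A context is a diagram with,
besides its boundary `B`, one port for every leg of the pattern; the edge of `C` at the port `p`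
becomes the edge at the leg `p` of the pattern. (An edge of `C` between two ports becomes an edge
between two legs of the pattern, and an edge between a port and a boundary vertex becomes a
boundary edge.) -/
def plug (C : Diagram (B ⊕ P)) (D : Pattern P) : Diagram B where
  V := C.V ⊕ D.V
  E := C.E ⊕ D.E
  node := Sum.elim C.node D.node
  ends := C.plugEnds D
  hadamard_degree v hv := by
    rcases v with v | v
    · exact (C.card_plugEnds_inl D v).trans (C.hadamard_degree v hv)
    · exact (C.card_plugEnds_inr D v).trans (D.hadamard_degree v hv)
  boundary_degree b := by
    obtain ⟨⟨e, i⟩, h, huniq⟩ := C.boundary_degree (Sum.inl b)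
    refine ⟨(.inl e, i), congrArg (C.plugEnd D) h, ?_⟩
    rintro ⟨e' | e', i'⟩ h'
    · have hx : C.ends (e', i') = Sum.inr (Sum.inl b) := by
        rcases hx : C.ends (e', i') with w | b' | p <;> simp_all [plugEnds, plugEnd]
      have := huniq (e', i') hx
      simp_all
    · simp [plugEnds] at h'

end Diagram

namespace Pattern

variable {P : Type} [Fintype P]

/-- The rewrite `D₁ → D₂` is distance non-decreasing: `D₁` and `D₂` have the same interpretation,
and replacing `D₁` by `D₂`, in any context, does not decrease the ZX distance. -/
def DistanceNonDecreasing (D₁ D₂ : Pattern P) : Prop :=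
  SameUpToScalar D₁.toDiagram.interp D₂.toDiagram.interp ∧
    ∀ (B : Type) (C : Diagram (B ⊕ P)), (C.plug D₁).distance ≤ (C.plug D₂).distance

/-- The rewrite `D₁ → D₂` is distance-preserving: it and its inverse are distance non-decreasing. -/
def DistancePreserving (D₁ D₂ : Pattern P) : Prop :=
  DistanceNonDecreasing D₁ D₂ ∧ DistanceNonDecreasing D₂ D₁

end Pattern

/-- The `n`-legged Z-spider (with phase zero). -/
def zSpider (n : ℕ) : Pattern (Fin n) where
  V := Unit
  E := Empty
  node _ := Node.Z 0
  ends h := h.1.elim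
  leg _ := ()
  hadamard_degree _ h := Node.noConfusion h

/-- For even `n`, the diagram of Z-spiders (with phase zero) that consists of two inner spiders
`inl 0`, `inl 1` and of `n / 2` outer spiders `inr i`. There is one internal edge `(i, s)` between
each outer spider `inr i` and each inner spider `inl s`, and the outer spider `inr i` carries the
legs `2 * i` and `2 * i + 1`. So inner spiders have `n / 2` legs and outer spiders have four. -/
def splitSpider (n : ℕ) (hn : Even n) : Pattern (Fin n) where
  V := Fin 2 ⊕ Fin (n / 2)
  E := Fin (n / 2) × Fin 2
  node _ := Node.Z 0
  ends h := if h.2 = 0 then Sum.inl h.1.2 else Sum.inr h.1.1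
  leg p := Sum.inr ⟨(p : ℕ) / 2, Nat.div_lt_div_of_lt_of_dvd (even_iff_two_dvd.mp hn) p.isLt⟩
  hadamard_degree _ h := Node.noConfusion h

end ZX

namespace ZX

/-! An error on a context with a plugged pattern splits into flips on the context and flips inside
the pattern. The weights add, and the interpretation is the contraction of the flipped context with
the tensor of the flipped pattern (`interpError_plug`). So only the tensors of the two spiders have
to be compared. The Z-spider has no internal edges, and its tensor is always `ghz n`.

An error on the unsplit diagram therefore lies on the context, and it works unchanged for the split
one, whose flip-free tensor is proportional to `ghz n`.

Conversely, consider flips inside the split spider. Any two outer spiders form a 4-cycle with the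
inner ones, so the tensor vanishes unless the parity of `X` flips on the two edges of an outer
spider is the same for all of them. If this parity is even, each outer spider has zero or two
flipped edges, which are traded for its two legs. If it is odd, at least `n / 2` edges are flipped.
The resulting leg flips may be replaced by the complementary set, since `X` on all legs fixes `ghz
n`, and one of the two sets has at most `n / 2` legs. The `Z` flips amount to at most one sign
between the two global labellings, that is, to a `Z` on any one leg; it is put on a leg that already
carries an `X`, if there is one. So the flips move to at most as many legs
(`splitSpider_tensor_flips`), and from there to the context edges at the ports (`contract_flips`,
`contract_toggle_Z`). -/

/-! ### Coefficients of vertices and matrices of flips. -/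

theorem Node.coeff_comp_equiv {L L' : Type} [Fintype L] [Fintype L'] (N : Node) (e : L ≃ L')
    (x : L' → Fin 2) : N.coeff (fun l => x (e l)) = N.coeff x := by
  cases N with
  | Z k =>
    simp only [Node.coeff]
    rw [e.prod_comp (fun l => if x l = 0 then (1 : ℂ) else 0),
      e.prod_comp (fun l => if x l = 1 then (1 : ℂ) else 0)]
  | X k =>
    simp only [Node.coeff]
    rw [e.prod_comp (fun _ => 1 / (Real.sqrt 2 : ℂ)),
      e.prod_comp (fun l => (if x l = 0 then 1 else -1) / (Real.sqrt 2 : ℂ))]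
  | H =>
    simp only [Node.coeff, e.forall_congr_left, Equiv.apply_symm_apply]

/-- A phase-free Z-spider forces all its legs to carry a common label. -/
theorem Node.coeff_Z_zero {L : Type} [Fintype L] (x : L → Fin 2) :
    (Node.Z 0).coeff x = ∑ b : Fin 2, ∏ l, if x l = b then (1 : ℂ) else 0 := by
  simp [Node.coeff, Fin.sum_univ_two]

open Classical in
/-- The product of the flips of `ε` on the edge `e`. -/
noncomputable def edgeFlip {E : Type} (ε : Finset (E × Flip)) (e : E) :
    Matrix (Fin 2) (Fin 2) ℂ :=
  (if (e, Flip.X) ∈ ε then Flip.X.matrix else 1) * (if (e, Flip.Z) ∈ ε then Flip.Z.matrix else 1)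

theorem Flip.matrix_X : Flip.X.matrix = !![0, 1; 1, 0] := by
  have h : (Real.sqrt 2 : ℂ) * Real.sqrt 2 = 2 := by
    rw [← Complex.ofReal_mul, Real.mul_self_sqrt (by norm_num)]; norm_num
  have h' : (Real.sqrt 2 : ℂ)⁻¹ * (Real.sqrt 2 : ℂ)⁻¹ = 1 / 2 := by
    rw [← mul_inv, h]; norm_num
  ext a b
  fin_cases a <;> fin_cases b <;>
    simp [Flip.matrix, Flip.node, Node.coeff, neg_div] <;> simp [sq, h'] <;> norm_num

theorem Flip.matrix_Z : Flip.Z.matrix = !![1, 0; 0, -1] := by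
  ext a b
  fin_cases a <;> fin_cases b <;> simp [Flip.matrix, Flip.node, Node.coeff]

open Classical in
-- The matrix is a power of `X` times a power of `Z`, so the sign is read at the column label `b`.
theorem edgeFlip_apply {E : Type} (ε : Finset (E × Flip)) (e : E) (a b : Fin 2) :
    edgeFlip ε e a b =
      if a = b + (if (e, Flip.X) ∈ ε then 1 else 0) then
        if (e, Flip.Z) ∈ ε ∧ b = 1 then -1 else 1 else 0 := by
  rw [edgeFlip, Flip.matrix_X, Flip.matrix_Z]
  by_cases hx : (e, Flip.X) ∈ ε <;> by_cases hz : (e, Flip.Z) ∈ ε <;>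
    simp only [hx, hz, if_true, if_false] <;> fin_cases a <;> fin_cases b <;> simp

theorem edgeFlip_congr {E E' : Type} {ε : Finset (E × Flip)} {ε' : Finset (E' × Flip)} {e : E}
    {e' : E'} (h : ∀ t, (e, t) ∈ ε ↔ (e', t) ∈ ε') : edgeFlip ε e = edgeFlip ε' e' := by
  classical
  unfold edgeFlip
  congr 1 <;> exact ite_congr (propext (h _)) (fun _ => rfl) (fun _ => rfl)

/-! ### Tensors of patterns. -/

/-- Labellings of the ends of two sets of edges are pairs of labellings. -/
def labellingSumEquiv (E E' : Type) :
    (((E ⊕ E') × Fin 2) → Fin 2) ≃ ((E × Fin 2 → Fin 2) × (E' × Fin 2 → Fin 2)) where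
  toFun x := (fun h => x (.inl h.1, h.2), fun h => x (.inr h.1, h.2))
  invFun x h := Sum.elim (fun e => x.1 (e, h.2)) (fun e => x.2 (e, h.2)) h.1
  left_inv x := by
    funext ⟨e, i⟩
    cases e <;> rfl
  right_inv x := rfl

theorem sum_labelling {E E' : Type} [Fintype (E × Fin 2 → Fin 2)]
    [Fintype (E' × Fin 2 → Fin 2)] {_ : Fintype ((E ⊕ E') × Fin 2 → Fin 2)}
    {f : ((E ⊕ E') × Fin 2 → Fin 2) → ℂ}
    (g : (E × Fin 2 → Fin 2) × (E' × Fin 2 → Fin 2) → ℂ)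
    (h : ∀ x, f x = g (labellingSumEquiv E E' x)) :
    ∑ x, f x = ∑ x, ∑ z, g (x, z) := by
  rw [← Fintype.sum_prod_type, ← (labellingSumEquiv E E').sum_comp g]
  exact Finset.sum_congr rfl fun x _ => h x

open Classical in
/-- The tensor of a pattern with the flips of `η` on its internal edges, at the labels `w` of
its legs. -/
noncomputable def Pattern.tensor {P : Type} [Fintype P] (D : Pattern P)
    (η : Finset (D.E × Flip)) (w : P → Fin 2) : ℂ :=
  ∑ x : D.E × Fin 2 → Fin 2, (∏ e, edgeFlip η e (x (e, 0)) (x (e, 1))) *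
    ∏ v, (D.node v).coeff (Sum.elim (fun h : {h : D.E × Fin 2 // D.ends h = v} => x h)
      (fun p : {p : P // D.leg p = v} => w p))

theorem edgeFlip_empty {E : Type} (e : E) : edgeFlip (∅ : Finset (E × Flip)) e = 1 := by
  simp [edgeFlip]

/-- The ends at a vertex of the diagram of a pattern. -/
noncomputable def Pattern.diagramEndsEquiv {P : Type} (D : Pattern P) (v : D.V) :
    {h : D.E × Fin 2 // D.ends h = v} ⊕ {p : P // D.leg p = v} ≃
      {h // D.diagramEnds h = Sum.inl v} :=
  Equiv.ofBijective
    (Sum.elim (fun h => ⟨(.inl h.1.1, h.1.2), congrArg Sum.inl h.2⟩)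
      (fun p => ⟨(.inr p.1, 0), congrArg Sum.inl p.2⟩)) (by
  constructor
  · rintro (⟨⟨e, i⟩, h⟩ | ⟨p, h⟩) (⟨⟨e', i'⟩, h'⟩ | ⟨p', h'⟩) hh <;>
      replace hh := congrArg Subtype.val hh <;> simp_all
  · rintro ⟨⟨e | p, i⟩, h⟩
    · exact ⟨.inl ⟨(e, i), Sum.inl.inj h⟩, rfl⟩
    · fin_cases i
      · exact ⟨.inr ⟨p, Sum.inl.inj h⟩, rfl⟩
      · exact (Sum.inr_ne_inl h).elim)

/-- Boundary edges carry no flips here, so each contributes an identity matrix and just passes the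
boundary label on to its leg. -/
theorem Pattern.interp_toDiagram {P : Type} [Fintype P] (D : Pattern P) (y : P → Fin 2) :
    D.toDiagram.interp y = D.tensor ∅ y := by
  classical
  have hvertex (x : (D.E ⊕ P) × Fin 2 → Fin 2) (v : D.V) :
      (D.node v).coeff (fun h : {h // D.diagramEnds h = Sum.inl v} => x h) =
        (D.node v).coeff (Sum.elim
          (fun h : {h : D.E × Fin 2 // D.ends h = v} => (labellingSumEquiv D.E P x).1 h)
          (fun p : {p : P // D.leg p = v} => (labellingSumEquiv D.E P x).2 (p.1, 0))) := by
    rw [← Node.coeff_comp_equiv _ (D.diagramEndsEquiv v)]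
    congr 1
    funext l
    rcases l with h | p <;> rfl
  have hbdry (x : (D.E ⊕ P) × Fin 2 → Fin 2) :
      (∀ h b, D.diagramEnds h = Sum.inr b → x h = y b) ↔
        ∀ p, (labellingSumEquiv D.E P x).2 (p, 1) = y p := by
    constructor
    · exact fun h p => h (.inr p, 1) p rfl
    · rintro h ⟨e | p, i⟩ b hb
      · simp [Pattern.diagramEnds] at hb
      · fin_cases i
        · simp [Pattern.diagramEnds] at hb
        · obtain rfl : p = b := by simpa [Pattern.diagramEnds] using hb
          exact h p
  refine (sum_labelling (E := D.E) (E' := P)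
      (fun z : (D.E × Fin 2 → Fin 2) × (P × Fin 2 → Fin 2) =>
        if ∀ p, z.2 (p, 1) = y p then
          ((∏ e, (1 : Matrix (Fin 2) (Fin 2) ℂ) (z.1 (e, 0)) (z.1 (e, 1))) *
            ∏ p, (1 : Matrix (Fin 2) (Fin 2) ℂ) (z.2 (p, 0)) (z.2 (p, 1))) *
          ∏ v, (D.node v).coeff (Sum.elim
            (fun h : {h : D.E × Fin 2 // D.ends h = v} => z.1 h)
            (fun p : {p : P // D.leg p = v} => z.2 (p.1, 0)))
        else 0) fun x => ?_).trans ?_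
  · refine ite_congr (propext (hbdry x)) (fun _ => ?_) (fun _ => rfl)
    refine congrArg₂ (· * ·) ?_ (Finset.prod_congr rfl fun v _ => hvertex x v)
    refine (Finset.prod_congr rfl fun e _ => ?_).trans (Fintype.prod_sum_type
      (fun e : D.E ⊕ P => (1 : Matrix (Fin 2) (Fin 2) ℂ) (x (e, 0)) (x (e, 1))))
    exact congrFun (congrFun (edgeFlip_empty e) _) _
  rw [Pattern.tensor]
  refine Finset.sum_congr rfl fun x _ => ?_
  rw [Fintype.sum_eq_single (fun h => y h.1)]
  · simp [edgeFlip_empty]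
  · intro z hz
    split_ifs with h
    · have hp : ∃ p, z (p, 0) ≠ z (p, 1) := by
        by_contra! hp
        refine hz (funext fun ⟨p, i⟩ => ?_)
        fin_cases i
        · exact (hp p).trans (h p)
        · exact h p
      obtain ⟨p, hp⟩ := hp
      have h0 : ∏ p, (1 : Matrix (Fin 2) (Fin 2) ℂ) (z (p, 0)) (z (p, 1)) = 0 :=
        Finset.prod_eq_zero (Finset.mem_univ p) (Matrix.one_apply_ne hp)
      simp only [h0, mul_zero, zero_mul]
    · rfl

/-! ### Contraction of a context with a tensor on its ports. -/

namespace Diagram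

variable {B P : Type}

/-- The end at the port `p` of a context. -/
noncomputable def port (C : Diagram (B ⊕ P)) (p : P) : C.E × Fin 2 :=
  (C.boundary_degree (Sum.inr p)).choose

theorem ends_port (C : Diagram (B ⊕ P)) (p : P) : C.ends (C.port p) = Sum.inr (Sum.inr p) :=
  (C.boundary_degree (Sum.inr p)).choose_spec.1

theorem eq_port (C : Diagram (B ⊕ P)) {p : P} {h : C.E × Fin 2}
    (hp : C.ends h = Sum.inr (Sum.inr p)) : h = C.port p :=
  (C.boundary_degree (Sum.inr p)).choose_spec.2 h hp

theorem port_injective (C : Diagram (B ⊕ P)) : Function.Injective C.port := fun p q h => by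
  have := C.ends_port p
  rw [h, C.ends_port q] at this
  exact (Sum.inr.inj (Sum.inr.inj this)).symm

/-- The ends at a vertex of the context. -/
noncomputable def plugEndsEquivLeft (C : Diagram (B ⊕ P)) (D : Pattern P) (v : C.V) :
    {h // C.ends h = Sum.inl v} ≃ {h // C.plugEnds D h = Sum.inl (Sum.inl v)} :=
  Equiv.ofBijective
    (fun h => ⟨(.inl h.1.1, h.1.2), congrArg (C.plugEnd D) h.2⟩) (by
  constructor
  · rintro ⟨⟨e, i⟩, h⟩ ⟨⟨e', i'⟩, h'⟩ hh
    replace hh := congrArg Subtype.val hh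
    simp_all
  · rintro ⟨⟨e | e, i⟩, h⟩
    · refine ⟨⟨(e, i), ?_⟩, rfl⟩
      rcases hx : C.ends (e, i) with w | b | p <;> simp_all [plugEnds, plugEnd]
    · simp [plugEnds] at h)

/-- The ends at a vertex of the plugged pattern. -/
noncomputable def plugEndsEquivRight (C : Diagram (B ⊕ P)) (D : Pattern P) (v : D.V) :
    {h : D.E × Fin 2 // D.ends h = v} ⊕ {p : P // D.leg p = v} ≃
      {h // C.plugEnds D h = Sum.inl (Sum.inr v)} :=
  Equiv.ofBijective
    (Sum.elim (fun h => ⟨(.inr h.1.1, h.1.2), congrArg (fun w => Sum.inl (Sum.inr w)) h.2⟩)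
      (fun p => ⟨(.inl (C.port p.1).1, (C.port p.1).2),
        (congrArg (C.plugEnd D) (C.ends_port p.1)).trans
          (congrArg (fun w => Sum.inl (Sum.inr w)) p.2)⟩)) (by
  constructor
  · rintro (⟨⟨e, i⟩, h⟩ | ⟨p, h⟩) (⟨⟨e', i'⟩, h'⟩ | ⟨p', h'⟩) hh <;>
      replace hh := congrArg Subtype.val hh
    · simp_all
    · simp at hh
    · simp at hh
    · have hpq : C.port p = C.port p' := by
        simp only [Sum.elim_inr, Prod.mk.injEq, Sum.inl.injEq] at hh
        exact Prod.ext hh.1 hh.2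
      obtain rfl := C.port_injective hpq
      rfl
  · rintro ⟨⟨e | e, i⟩, h⟩
    · rcases hx : C.ends (e, i) with w | b | p
      · simp [plugEnds, plugEnd, hx] at h
      · simp [plugEnds, plugEnd, hx] at h
      · have hp : D.leg p = v := by simpa [plugEnds, plugEnd, hx] using h
        refine ⟨.inr ⟨p, hp⟩, ?_⟩
        simp [← C.eq_port hx]
    · exact ⟨.inl ⟨(e, i), by simpa [plugEnds] using h⟩, rfl⟩)

open Classical in
/-- The contraction of a context, with the flips of `ε` on its edges, with a tensor `T` on its
ports. -/
noncomputable def contract (C : Diagram (B ⊕ P)) (ε : C.Error) (T : (P → Fin 2) → ℂ)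
    (y : B → Fin 2) : ℂ :=
  ∑ x : C.E × Fin 2 → Fin 2,
    if ∀ h b, C.ends h = Sum.inr (Sum.inl b) → x h = y b then
      (∏ e, edgeFlip ε e (x (e, 0)) (x (e, 1))) *
        (∏ v, (C.node v).coeff (fun h : {h : C.E × Fin 2 // C.ends h = Sum.inl v} => x h)) *
        T (fun p => x (C.port p))
    else 0

open Classical in
/-- The part of an error on the left summand of the edges. -/
noncomputable def errorLeft {E E' : Type} (ε : Finset ((E ⊕ E') × Flip)) : Finset (E × Flip) :=
  ε.preimage (Prod.map Sum.inl id) (Sum.inl_injective.prodMap Function.injective_id).injOn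

open Classical in
/-- The part of an error on the right summand of the edges. -/
noncomputable def errorRight {E E' : Type} (ε : Finset ((E ⊕ E') × Flip)) : Finset (E' × Flip) :=
  ε.preimage (Prod.map Sum.inr id) (Sum.inr_injective.prodMap Function.injective_id).injOn

/-- Vertices and edges are those of the context together with those of the pattern, and the two
labellings interact only through the labels at the ports. Hence a pattern matters only through its
tensor. -/
theorem interpError_plug [Fintype P] (C : Diagram (B ⊕ P)) (D : Pattern P)
    (ε : Finset ((C.E ⊕ D.E) × Flip)) (y : B → Fin 2) :
    (C.plug D).interpError ε y = C.contract (errorLeft ε) (D.tensor (errorRight ε)) y := by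
  classical
  have hleft (x : (C.E ⊕ D.E) × Fin 2 → Fin 2) (v : C.V)
      (_ : Fintype {h // C.plugEnds D h = Sum.inl (Sum.inl v)}) :
      (C.node v).coeff (fun h : {h // C.plugEnds D h = Sum.inl (Sum.inl v)} => x h) =
        (C.node v).coeff (fun h : {h : C.E × Fin 2 // C.ends h = Sum.inl v} =>
          (labellingSumEquiv C.E D.E x).1 h) :=
    (Node.coeff_comp_equiv _ (C.plugEndsEquivLeft D v) _).symm
  have hright (x : (C.E ⊕ D.E) × Fin 2 → Fin 2) (v : D.V)
      (_ : Fintype {h // C.plugEnds D h = Sum.inl (Sum.inr v)}) :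
      (D.node v).coeff (fun h : {h // C.plugEnds D h = Sum.inl (Sum.inr v)} => x h) =
        (D.node v).coeff (Sum.elim
          (fun h : {h : D.E × Fin 2 // D.ends h = v} => (labellingSumEquiv C.E D.E x).2 h)
          (fun p : {p : P // D.leg p = v} => (labellingSumEquiv C.E D.E x).1 (C.port p))) := by
    rw [← Node.coeff_comp_equiv _ (C.plugEndsEquivRight D v)]
    congr 1
    funext l
    rcases l with h | p <;> rfl
  have hbdry (x : (C.E ⊕ D.E) × Fin 2 → Fin 2) :
      (∀ h b, C.plugEnds D h = Sum.inr b → x h = y b) ↔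
        ∀ h b, C.ends h = Sum.inr (Sum.inl b) → (labellingSumEquiv C.E D.E x).1 h = y b := by
    constructor
    · exact fun h l b hb => h (.inl l.1, l.2) b (congrArg (C.plugEnd D) hb)
    · rintro h ⟨e | e, i⟩ b hb
      · refine h (e, i) b ?_
        rcases hx : C.ends (e, i) with w | b' | p <;> simp_all [plugEnds, plugEnd]
      · simp [plugEnds] at hb
  refine (sum_labelling (E := C.E) (E' := D.E)
      (fun z : (C.E × Fin 2 → Fin 2) × (D.E × Fin 2 → Fin 2) =>
        if ∀ h b, C.ends h = Sum.inr (Sum.inl b) → z.1 h = y b then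
          ((∏ e, edgeFlip (errorLeft ε) e (z.1 (e, 0)) (z.1 (e, 1))) *
            ∏ e, edgeFlip (errorRight ε) e (z.2 (e, 0)) (z.2 (e, 1))) *
          ((∏ v, (C.node v).coeff
            (fun h : {h : C.E × Fin 2 // C.ends h = Sum.inl v} => z.1 h)) *
          ∏ v, (D.node v).coeff (Sum.elim
            (fun h : {h : D.E × Fin 2 // D.ends h = v} => z.2 h)
            (fun p : {p : P // D.leg p = v} => z.1 (C.port p))))
        else 0) fun x => ?_).trans ?_
  · refine ite_congr (propext (hbdry x)) (fun _ => ?_) (fun _ => rfl)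
    refine congrArg₂ (· * ·) ?_ ?_
    · refine (Fintype.prod_sum_type
        (fun e : C.E ⊕ D.E => edgeFlip ε e (x (e, 0)) (x (e, 1)))).trans ?_
      refine congrArg₂ (· * ·) (Finset.prod_congr rfl fun e _ => ?_)
        (Finset.prod_congr rfl fun e _ => ?_)
      · exact congrFun₂ (edgeFlip_congr fun t => by simp [errorLeft]) _ _
      · exact congrFun₂ (edgeFlip_congr fun t => by simp [errorRight]) _ _
    · refine (Fintype.prod_sum_type _).trans ?_
      exact congrArg₂ (· * ·) (Finset.prod_congr rfl fun v _ => hleft x v _)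
        (Finset.prod_congr rfl fun v _ => hright x v _)
  rw [contract]
  refine Finset.sum_congr rfl fun x _ => ?_
  split_ifs
  · rw [Pattern.tensor, Finset.mul_sum]
    refine Finset.sum_congr rfl fun z _ => ?_
    ring
  · simp

open Classical in
/-- The number of edges that an error affects. -/
noncomputable def errorWeight {E : Type} (ε : Finset (E × Flip)) : ℕ := (ε.image Prod.fst).card

theorem errorWeight_eq_add {E E' : Type} (ε : Finset ((E ⊕ E') × Flip)) :
    errorWeight ε = errorWeight (errorLeft ε) + errorWeight (errorRight ε) := by
  classical
  rw [errorWeight, errorWeight, errorWeight, ← Finset.card_disjSum]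
  refine congrArg Finset.card ?_
  ext e
  rcases e with e | e <;> simp [errorLeft, errorRight]

theorem weight_plug (C : Diagram (B ⊕ P)) (D : Pattern P) (ε : Finset ((C.E ⊕ D.E) × Flip)) :
    (C.plug D).weight ε = errorWeight (errorLeft ε) + errorWeight (errorRight ε) :=
  errorWeight_eq_add ε

end Diagram

/-! ### Moving flips from the ports to the edges of the context. -/

open scoped symmDiff

/-- The labelling `w` with its label at `p` flipped. -/
def flipAt {A : Type} [DecidableEq A] (p : A) (w : A → Fin 2) (q : A) : Fin 2 :=
  w q + if q = p then 1 else 0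

theorem flipAt_involutive {A : Type} [DecidableEq A] (p : A) :
    Function.Involutive (flipAt p) := by
  intro w
  funext q
  have h : (1 : Fin 2) + 1 = 0 := rfl
  simp only [flipAt]
  split_ifs <;> simp [add_assoc, h]

open Classical in
/-- Flipping the label at an end amounts to toggling an `X` flip, up to a sign. -/
theorem edgeFlip_toggle_X {E : Type} (ε : Finset (E × Flip)) (h₀ : E × Fin 2) :
    ∃ c : ℂ, c ≠ 0 ∧ ∀ (e : E) (x : E × Fin 2 → Fin 2),
      edgeFlip (ε ∆ {(h₀.1, Flip.X)}) e (flipAt h₀ x (e, 0)) (flipAt h₀ x (e, 1)) =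
        (if e = h₀.1 then c else 1) * edgeFlip ε e (x (e, 0)) (x (e, 1)) := by
  obtain ⟨e₀, i⟩ := h₀
  -- End 1 is where the `Z` sign is read, so only flipping the label there changes it.
  refine ⟨if (e₀, Flip.Z) ∈ ε ∧ i = 1 then -1 else 1, by split_ifs <;> simp, fun e x => ?_⟩
  by_cases he : e = e₀
  · subst he
    generalize ha : x (e, 0) = a
    generalize hb : x (e, 1) = b
    simp only [edgeFlip_apply, flipAt, ha, hb, Finset.mem_symmDiff, Finset.mem_singleton]
    by_cases hx : (e, Flip.X) ∈ ε <;> by_cases hz : (e, Flip.Z) ∈ ε <;>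
      fin_cases i <;> fin_cases a <;> fin_cases b <;> simp [hx, hz]
  · rw [edgeFlip_congr (ε' := ε) (e' := e) fun t => by simp [Finset.mem_symmDiff, he]]
    simp [flipAt, he]

open Classical in
/-- The sign of the label at an end amounts to toggling a `Z` flip, up to a sign. -/
theorem edgeFlip_toggle_Z {E : Type} (ε : Finset (E × Flip)) (h₀ : E × Fin 2) :
    ∃ c : ℂ, c ≠ 0 ∧ ∀ (e : E) (x : E × Fin 2 → Fin 2),
      edgeFlip (ε ∆ {(h₀.1, Flip.Z)}) e (x (e, 0)) (x (e, 1)) =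
        (if e = h₀.1 then c * (if x h₀ = 1 then -1 else 1) else 1) *
          edgeFlip ε e (x (e, 0)) (x (e, 1)) := by
  obtain ⟨e₀, i⟩ := h₀
  -- The sign at end 0 differs from the sign at end 1 exactly when an `X` flip makes the two labels
  -- differ.
  refine ⟨if (e₀, Flip.X) ∈ ε ∧ i = 0 then -1 else 1, by split_ifs <;> simp, fun e x => ?_⟩
  by_cases he : e = e₀
  · subst he
    generalize ha : x (e, 0) = a
    generalize hb : x (e, 1) = b
    fin_cases i <;>
    simp only [edgeFlip_apply, ha, hb, Finset.mem_symmDiff, Finset.mem_singleton, Fin.mk_zero,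
        Fin.mk_one, Fin.isValue] <;>
      by_cases hx : (e, Flip.X) ∈ ε <;> by_cases hz : (e, Flip.Z) ∈ ε <;>
      fin_cases a <;> fin_cases b <;> simp [hx, hz]
  · rw [edgeFlip_congr (ε' := ε) (e' := e) fun t => by simp [Finset.mem_symmDiff, he]]
    simp [he]

namespace Diagram

variable {B P : Type}

open Classical in
/-- A flip of the label at a port is moved to an `X` flip on the edge at the port. -/
theorem contract_toggle_X [DecidableEq P] (C : Diagram (B ⊕ P)) (ε : C.Error) (p : P) :
    ∃ c : ℂ, c ≠ 0 ∧ ∀ T, C.contract (ε ∆ {((C.port p).1, Flip.X)}) T =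
      c • C.contract ε (fun w => T (flipAt p w)) := by
  obtain ⟨c, hc, h⟩ := edgeFlip_toggle_X ε (C.port p)
  refine ⟨c, hc, fun T => funext fun y => ?_⟩
  simp only [contract, Pi.smul_apply, smul_eq_mul, Finset.mul_sum]
  -- Change of summation variable: only the edge at the port and `T` see the flipped label, since a
  -- port is an end neither at a vertex of `C` nor at the boundary `B`.
  rw [← Equiv.sum_comp (flipAt_involutive (C.port p)).toPerm]
  refine Finset.sum_congr rfl fun x _ => ?_
  have hne {h : C.E × Fin 2} {a} (ha : C.ends h = a) (hap : a ≠ Sum.inr (Sum.inr p)) :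
      flipAt (C.port p) x h = x h := by
    have : h ≠ C.port p := by
      rintro rfl
      exact hap (ha.symm.trans (C.ends_port p))
    simp [flipAt, this]
  simp only [Function.Involutive.coe_toPerm, mul_ite, mul_zero]
  refine ite_congr (propext (forall_congr' fun l => forall_congr' fun b =>
    imp_congr_right fun hb => ?_)) (fun _ => ?_) (fun _ => rfl)
  · rw [hne hb (by simp)]
  · simp only [h, Finset.prod_mul_distrib, Finset.prod_ite_eq', Finset.mem_univ, if_true]
    have hT : (fun q => flipAt (C.port p) x (C.port q)) = flipAt p fun q => x (C.port q) := by
      funext q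
      simp [flipAt, C.port_injective.eq_iff]
    have hv (v : C.V) : (fun l : {l // C.ends l = Sum.inl v} => flipAt (C.port p) x l.1) =
        fun l : {l // C.ends l = Sum.inl v} => x l.1 := funext fun l => hne l.2 (by simp)
    simp only [hT, hv]
    ring

open Classical in
/-- The sign of the label at a port is moved to a `Z` flip on the edge at the port. -/
theorem contract_toggle_Z (C : Diagram (B ⊕ P)) (ε : C.Error) (p : P) :
    ∃ c : ℂ, c ≠ 0 ∧ ∀ T, C.contract (ε ∆ {((C.port p).1, Flip.Z)}) T =
      c • C.contract ε (fun w => (if w p = 1 then -1 else 1) * T w) := by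
  obtain ⟨c, hc, h⟩ := edgeFlip_toggle_Z ε (C.port p)
  refine ⟨c, hc, fun T => funext fun y => ?_⟩
  simp only [contract, Pi.smul_apply, smul_eq_mul, Finset.mul_sum, mul_ite, mul_zero]
  refine Finset.sum_congr rfl fun x _ => ?_
  refine ite_congr rfl (fun _ => ?_) (fun _ => rfl)
  simp only [h, Finset.prod_mul_distrib, Finset.prod_ite_eq', Finset.mem_univ, if_true]
  split_ifs <;> ring

open Classical in
-- Only an inclusion holds: toggling may cancel the last flip on an edge.
theorem image_fst_toggle_subset {E : Type} (ε : Finset (E × Flip)) (e : E) (t : Flip) :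
    (ε ∆ {(e, t)}).image Prod.fst ⊆ insert e (ε.image Prod.fst) := by
  intro a ha
  obtain ⟨⟨b, s⟩, hb, rfl⟩ := Finset.mem_image.1 ha
  rcases Finset.mem_symmDiff.1 hb with h | h
  · exact Finset.mem_insert_of_mem (Finset.mem_image_of_mem _ h.1)
  · rw [Finset.mem_singleton.1 h.1]
    exact Finset.mem_insert_self _ _

open Classical in
/-- Flips of the labels at the ports in `Q` are moved to the edges at these ports. -/
theorem contract_flips [DecidableEq P] (C : Diagram (B ⊕ P)) (ε : C.Error) (Q : Finset P) :
    ∃ ε' : C.Error, ε'.image Prod.fst ⊆ ε.image Prod.fst ∪ Q.image (fun p => (C.port p).1) ∧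
      ∃ c : ℂ, c ≠ 0 ∧ ∀ T, C.contract ε' T =
        c • C.contract ε (fun w => T (fun q => w q + if q ∈ Q then 1 else 0)) := by
  induction Q using Finset.induction_on with
  | empty => exact ⟨ε, by simp, 1, one_ne_zero, fun T => by simp⟩
  | insert p Q hp ih =>
    obtain ⟨ε', hsub, c, hc, h⟩ := ih
    -- The flip is toggled, not inserted: the edge may already carry an `X`, for instance when it
    -- joins two ports in `Q`.
    obtain ⟨c', hc', h'⟩ := C.contract_toggle_X ε' p
    refine ⟨_, (image_fst_toggle_subset ε' (C.port p).1 Flip.X).trans ?_, c' * c,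
      mul_ne_zero hc' hc, fun T => ?_⟩
    · rw [Finset.image_insert, Finset.union_insert]
      exact Finset.insert_subset_insert _ hsub
    · rw [h', h, smul_smul]
      congr 2
      funext w
      congr 1
      funext q
      by_cases hq : q = p
      · subst hq
        simp [flipAt, hp]
      · simp [flipAt, hq]

end Diagram

/-! ### Tensors of the two spider patterns. -/

/-- The tensor of a pattern of phase-free Z-spiders is a sum over the common labels at the
spiders. -/
theorem Pattern.tensor_eq_sum_of_node {P : Type} [Fintype P] (D : Pattern P)
    {_ : Fintype (D.V → Fin 2)}
    (hD : ∀ v, D.node v = Node.Z 0) (η : Finset (D.E × Flip)) (w : P → Fin 2) :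
    D.tensor η w = ∑ β : D.V → Fin 2,
      (∏ e, edgeFlip η e (β (D.ends (e, 0))) (β (D.ends (e, 1)))) *
        ∏ p, if w p = β (D.leg p) then 1 else 0 := by
  classical
  have hfib {A : Type} [Fintype A] (f : A → D.V) (β : D.V → Fin 2) (z : A → Fin 2) :
      ∏ v, ∏ a : {a // f a = v}, (if z a = β v then (1 : ℂ) else 0) =
        ∏ a, if z a = β (f a) then 1 else 0 := by
    rw [← Fintype.prod_fiberwise f]
    exact Finset.prod_congr rfl fun v _ => Finset.prod_congr rfl fun a _ => by simp only [a.2]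
  have hcoeff (x : D.E × Fin 2 → Fin 2) :
      ∏ v, (D.node v).coeff (Sum.elim (fun h : {h : D.E × Fin 2 // D.ends h = v} => x h)
        (fun p : {p : P // D.leg p = v} => w p)) =
      ∑ β : D.V → Fin 2, (if x = fun h => β (D.ends h) then 1 else 0) *
        ∏ p, if w p = β (D.leg p) then (1 : ℂ) else 0 := by
    simp only [hD, Node.coeff_Z_zero, Finset.prod_univ_sum, Fintype.piFinset_univ]
    refine Finset.sum_congr (by ext; simp) fun β _ => ?_
    refine (Finset.prod_congr rfl fun v _ => Fintype.prod_sum_type _).trans ?_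
    refine Finset.prod_mul_distrib.trans (congrArg₂ (· * ·) ?_ (hfib D.leg β w))
    refine (hfib D.ends β x).trans ?_
    simp [Finset.prod_ite_zero, funext_iff]
  simp only [Pattern.tensor, hcoeff, Finset.mul_sum]
  rw [Finset.sum_comm]
  refine Finset.sum_congr rfl fun β _ => ?_
  rw [Fintype.sum_eq_single (fun h => β (D.ends h))]
  · simp
  · intro x hx
    simp [hx]

theorem zSpider_tensor (n : ℕ) (η : Finset ((zSpider n).E × Flip)) (w : Fin n → Fin 2) :
    (zSpider n).tensor η w = ∑ c : Fin 2, ∏ p, if w p = c then 1 else 0 := by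
  have h : (zSpider n).tensor η w =
      ∑ β : Unit → Fin 2, 1 * ∏ p : Fin n, if w p = β () then (1 : ℂ) else 0 :=
    (Pattern.tensor_eq_sum_of_node (zSpider n) (fun _ => rfl) η w).trans
      (Finset.sum_congr rfl fun β _ => congrArg₂ (· * ·) (Fintype.prod_empty (ι := Empty) _) rfl)
  rw [h, ← (Equiv.funUnique Unit (Fin 2)).symm.sum_comp]
  simp

variable {n : ℕ}

open Classical in
/-- The label change along an internal edge of the split spider. -/
noncomputable def edgeShift {E : Type} (η : Finset (E × Flip)) (e : E) : Fin 2 :=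
  if (e, Flip.X) ∈ η then 1 else 0

open Classical in
/-- The sign of an internal edge of the split spider whose end at the outer spider has label `b`. -/
noncomputable def edgeSign {E : Type} (η : Finset (E × Flip)) (e : E) (b : Fin 2) : ℂ :=
  if (e, Flip.Z) ∈ η ∧ b = 1 then -1 else 1

theorem edgeFlip_apply_shift {E : Type} (η : Finset (E × Flip)) (e : E) (a b : Fin 2) :
    edgeFlip η e a b = if a = b + edgeShift η e then edgeSign η e b else 0 :=
  edgeFlip_apply η e a b

/-- The outer spider at a leg. -/
def outer (hn : Even n) (p : Fin n) : Fin (n / 2) :=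
  ⟨(p : ℕ) / 2, Nat.div_lt_div_of_lt_of_dvd (even_iff_two_dvd.mp hn) p.isLt⟩

theorem splitSpider_tensor (hn : Even n) (η : Finset ((Fin (n / 2) × Fin 2) × Flip))
    (w : Fin n → Fin 2) :
    (splitSpider n hn).tensor η w = ∑ β : Fin 2 ⊕ Fin (n / 2) → Fin 2,
      (∏ e : Fin (n / 2) × Fin 2, edgeFlip η e (β (.inl e.2)) (β (.inr e.1))) *
        ∏ p, if w p = β (.inr (outer hn p)) then 1 else 0 :=
  Pattern.tensor_eq_sum_of_node (splitSpider n hn) (fun _ => rfl) η w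

/-- If the cycles of the split spider carry different parities of `X` flips, its tensor is zero. -/
theorem splitSpider_tensor_eq_zero (hn : Even n) (η : Finset ((Fin (n / 2) × Fin 2) × Flip))
    {i j : Fin (n / 2)}
    (hij : edgeShift η (i, 0) + edgeShift η (i, 1) ≠ edgeShift η (j, 0) + edgeShift η (j, 1)) :
    (splitSpider n hn).tensor η = 0 := by
  funext w
  rw [splitSpider_tensor]
  refine Finset.sum_eq_zero fun β _ => ?_
  by_contra h0
  have h (e : Fin (n / 2) × Fin 2) : β (.inl e.2) = β (.inr e.1) + edgeShift η e := by
    by_contra h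
    refine Finset.prod_ne_zero_iff.1 (left_ne_zero_of_mul h0) e (Finset.mem_univ e) ?_
    rw [edgeFlip_apply_shift, if_neg h]
  -- Both parities equal `b₀ + b₁`, the difference of the labels of the two inner spiders.
  have key : ∀ b₀ b₁ a a' x₀ x₁ y₀ y₁ : Fin 2, b₀ = a + x₀ → b₁ = a + x₁ → b₀ = a' + y₀ →
      b₁ = a' + y₁ → x₀ + x₁ = y₀ + y₁ := by decide
  exact hij (key _ _ _ _ _ _ _ _ (h (i, 0)) (h (i, 1)) (h (j, 0)) (h (j, 1)))

/-- If all cycles of the split spider carry the same parity of `X` flips, a labelling of it is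
determined by the label of an inner spider. -/
theorem splitSpider_tensor_eq_sum (hn : Even n) (hpos : 0 < n)
    (η : Finset ((Fin (n / 2) × Fin 2) × Flip)) (k : Fin 2)
    (hk : ∀ i, edgeShift η (i, 0) + edgeShift η (i, 1) = k) (w : Fin n → Fin 2) :
    (splitSpider n hn).tensor η w = ∑ c : Fin 2,
      (∏ e : Fin (n / 2) × Fin 2, edgeSign η e (c + edgeShift η (e.1, 0))) *
        ∏ p, if w p = c + edgeShift η (outer hn p, 0) then 1 else 0 := by
  rw [splitSpider_tensor]
  symm
  refine Finset.sum_of_injOn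
    -- Here `c` labels the inner spider 0. The edge `(i, 0)` then forces the label of the outer
    -- spider `i`, and the inner spider 1 differs by the parity `k`.
    (fun c => Sum.elim ![c, c + k] fun i => c + edgeShift η (i, 0)) ?_ ?_ ?_ ?_
  · intro c _ c' _ h
    exact congrFun h (.inl 0)
  · intro c _
    simp
  · intro β _ hβ
    by_contra h0
    have h (e : Fin (n / 2) × Fin 2) : β (.inl e.2) = β (.inr e.1) + edgeShift η e := by
      by_contra h
      refine Finset.prod_ne_zero_iff.1 (left_ne_zero_of_mul h0) e (Finset.mem_univ e) ?_
      rw [edgeFlip_apply_shift, if_neg h]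
    have key : ∀ b₀ b₁ a x₀ x₁ k : Fin 2, b₀ = a + x₀ → b₁ = a + x₁ → x₀ + x₁ = k →
        b₁ = b₀ + k ∧ a = b₀ + x₀ := by decide
    refine hβ ⟨β (.inl 0), by simp, ?_⟩
    -- Some outer spider is needed to link the labels of the two inner ones; this is where `n = 0`
    -- differs.
    have i₀ : Fin (n / 2) := outer hn ⟨0, hpos⟩
    funext v
    rcases v with s | i
    · fin_cases s
      · rfl
      · exact (key _ _ _ _ _ _ (h (i₀, 0)) (h (i₀, 1)) (hk i₀)).1.symm
    · exact (key _ _ _ _ _ _ (h (i, 0)) (h (i, 1)) (hk i)).2.symm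
  · intro c _
    refine congrArg₂ (· * ·) (Finset.prod_congr rfl fun e _ => ?_) rfl
    have key : ∀ c x₀ x₁ k : Fin 2, x₀ + x₁ = k → c = c + x₀ + x₀ ∧ c + k = c + x₀ + x₁ := by
      decide
    refine ((edgeFlip_apply_shift _ _ _ _).trans (if_pos ?_)).symm
    obtain ⟨i, s⟩ := e
    fin_cases s
    · exact (key c _ _ _ (hk i)).1
    · exact (key c _ _ _ (hk i)).2

/-! ### Trading internal flips for flips on the legs. -/

open Diagram

theorem edgeShift_eq_one_iff {E : Type} {η : Finset (E × Flip)} {e : E} :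
    edgeShift η e = 1 ↔ (e, Flip.X) ∈ η := by
  simp [edgeShift]

theorem card_le_errorWeight {A E : Type} {η : Finset (E × Flip)} {s : Finset A} (f : A → E)
    (hf : ∀ a ∈ s, edgeShift η (f a) = 1) (hinj : Set.InjOn f s) : s.card ≤ errorWeight η := by
  classical
  exact Finset.card_le_card_of_injOn f (fun a ha => Finset.mem_coe.2
    (Finset.mem_image_of_mem Prod.fst (edgeShift_eq_one_iff.1 (hf a ha)))) hinj

open Classical in
/-- A global sign change between the two labellings needs a `Z` flip. -/
theorem prod_edgeSign {E : Type} [Fintype E] (η : Finset (E × Flip)) (u : E → Fin 2) :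
    ∏ e, edgeSign η e (0 + u e) ≠ 0 ∧
      (∏ e, edgeSign η e (1 + u e) = ∏ e, edgeSign η e (0 + u e) ∨
        (∏ e, edgeSign η e (1 + u e) = -∏ e, edgeSign η e (0 + u e) ∧
          1 ≤ errorWeight η)) := by
  refine ⟨Finset.prod_ne_zero_iff.2 fun e _ => by unfold edgeSign; split_ifs <;> simp, ?_⟩
  -- Complementing all labels changes the sign once for each `Z` flip.
  have h : ∏ e, edgeSign η e (1 + u e) =
      (∏ e, if (e, Flip.Z) ∈ η then (-1 : ℂ) else 1) * ∏ e, edgeSign η e (0 + u e) := by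
    rw [← Finset.prod_mul_distrib]
    refine Finset.prod_congr rfl fun e _ => ?_
    generalize u e = a
    by_cases hz : (e, Flip.Z) ∈ η <;> fin_cases a <;> simp [edgeSign, hz]
  rw [h]
  rcases Finset.eq_empty_or_nonempty η with rfl | hη
  · simp
  · have hcard : 1 ≤ errorWeight η := by
      classical
      exact Finset.card_pos.2 (hη.image _)
    have hsign : (∏ e, if (e, Flip.Z) ∈ η then (-1 : ℂ) else 1) = 1 ∨
        (∏ e, if (e, Flip.Z) ∈ η then (-1 : ℂ) else 1) = -1 := by
      rw [Finset.prod_ite, Finset.prod_const_one, mul_one, Finset.prod_const]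
      exact neg_one_pow_eq_or ℂ _
    rcases hsign with hs | hs
    · simp [hs]
    · exact .inr ⟨by rw [hs, neg_one_mul], hcard⟩

theorem card_filter_add_card_filter (u : Fin n → Fin 2) :
    (Finset.univ.filter fun p => u p = 1).card + (Finset.univ.filter fun p => u p + 1 = 1).card
      = n := by
  have key : ∀ a : Fin 2, a + 1 = 1 ↔ ¬ a = 1 := by decide
  simp only [key]
  rw [Finset.card_filter_add_card_filter_not, Finset.card_univ, Fintype.card_fin]

/-- The `X` flips inside the split spider can be traded for at most as many flips on its legs. -/
theorem exists_card_le (hn : Even n) (η : Finset ((Fin (n / 2) × Fin 2) × Flip)) (k : Fin 2)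
    (hk : ∀ i, edgeShift η (i, 0) + edgeShift η (i, 1) = k) :
    (Finset.univ.filter fun p => edgeShift η (outer hn p, 0) = 1).card ≤
        errorWeight η ∨
      (Finset.univ.filter fun p => edgeShift η (outer hn p, 0) + 1 = 1).card ≤
        errorWeight η := by
  have hsplit : k = 0 ∨ k = 1 := by fin_cases k <;> simp
  rcases hsplit with rfl | rfl
  -- Even parity: an outer spider with one `X`-flipped edge has two, and its legs are matched
  -- injectively with them.
  · left
    refine card_le_errorWeight
      (fun p => (outer hn p, (⟨(p : ℕ) % 2, Nat.mod_lt _ two_pos⟩ : Fin 2))) ?_ ?_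
    · intro p hp
      have hp : edgeShift η (outer hn p, 0) = 1 := by simpa using hp
      have h2 := hk (outer hn p)
      have key : ∀ x y : Fin 2, x + y = 0 → x = 1 → y = 1 := by decide
      have hall : ∀ s, edgeShift η (outer hn p, s) = 1 := by
        intro s
        fin_cases s
        · exact hp
        · exact key _ _ h2 hp
      exact hall _
    · intro p _ q _ h
      simp only [Prod.mk.injEq, outer, Fin.mk.injEq] at h
      apply Fin.ext
      omega
  -- Odd parity: every outer spider has an `X`-flipped edge, and the smaller of two complementary
  -- sets of legs has at most `n / 2` elements.
  · have hm : n / 2 ≤ errorWeight η := by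
      refine (Finset.card_fin (n / 2)).symm.trans_le ?_
      refine card_le_errorWeight
        (fun i => (i, if edgeShift η (i, 0) = 1 then 0 else 1)) ?_ ?_
      · intro i _
        have key : ∀ x y : Fin 2, x + y = 1 → x ≠ 1 → y = 1 := by decide
        by_cases h : edgeShift η (i, 0) = 1
        · simp [h]
        · simpa [h] using key _ _ (hk i) h
      · intro i _ j _ h
        exact congrArg Prod.fst h
    have := card_filter_add_card_filter fun p => edgeShift η (outer hn p, 0)
    obtain ⟨r, rfl⟩ := hn
    omega

/-- The tensor of the `n`-legged Z-spider. -/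
noncomputable def ghz (n : ℕ) (w : Fin n → Fin 2) : ℂ := ∑ c : Fin 2, ∏ p, if w p = c then 1 else 0

theorem add_ite_eq_iff (w u c : Fin 2) : w + (if u = 1 then 1 else 0) = c ↔ w = c + u := by
  revert w u c
  decide

theorem sum_shift_eq_ghz (u w : Fin n → Fin 2) :
    ∑ c : Fin 2, ∏ p, (if w p = c + u p then (1 : ℂ) else 0) =
      ghz n fun p => w p + if p ∈ Finset.univ.filter (fun p => u p = 1) then 1 else 0 := by
  simp [ghz, add_ite_eq_iff]

/-- A sign that depends on the common label is a sign at any one of the legs. -/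
theorem sum_signed_shift_eq_ghz (u w : Fin n → Fin 2) (q : Fin n) :
    ∏ p, (if w p = 0 + u p then (1 : ℂ) else 0) - ∏ p, (if w p = 1 + u p then (1 : ℂ) else 0) =
      (if (w q + if q ∈ Finset.univ.filter (fun p => u p = 1) then 1 else 0) = 1 then -1 else 1) *
        ghz n fun p => w p + if p ∈ Finset.univ.filter (fun p => u p = 1) then 1 else 0 := by
  -- The label of the leg `q` decides which of the two products can be nonzero.
  have h (c : Fin 2) (hc : ¬ w q = c + u q) :
      ∏ p, (if w p = c + u p then (1 : ℂ) else 0) = 0 :=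
    Finset.prod_eq_zero (Finset.mem_univ q) (if_neg hc)
  rw [← sum_shift_eq_ghz, Fin.sum_univ_two]
  simp only [Finset.mem_filter_univ, add_ite_eq_iff]
  by_cases hq : w q = 1 + u q
  · have key : ∀ w u : Fin 2, w = 1 + u → ¬ w = 0 + u := by decide
    rw [if_pos hq, h 0 (key _ _ hq)]
    ring
  · rw [if_neg hq, h 1 hq]
    ring

/-- The tensor of the split spider with internal flips is zero, or that of the Z-spider with
flips on at most as many legs. -/
theorem splitSpider_tensor_flips (hn : Even n) (hpos : 0 < n)
    (η : Finset ((Fin (n / 2) × Fin 2) × Flip)) (h0 : (splitSpider n hn).tensor η ≠ 0) :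
    ∃ (Q : Finset (Fin n)) (c : ℂ), c ≠ 0 ∧
      ((Q.card ≤ errorWeight η ∧ ∀ w, (splitSpider n hn).tensor η w =
          c * ghz n fun p => w p + if p ∈ Q then 1 else 0) ∨
        ∃ q, (insert q Q).card ≤ errorWeight η ∧
          ∀ w, (splitSpider n hn).tensor η w =
            c * ((if (w q + if q ∈ Q then 1 else 0) = 1 then -1 else 1) *
              ghz n fun p => w p + if p ∈ Q then 1 else 0)) := by
  obtain ⟨k, hk⟩ : ∃ k, ∀ i, edgeShift η (i, 0) + edgeShift η (i, 1) = k := by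
    refine ⟨_, fun i => not_not.1 fun h =>
      h0 (splitSpider_tensor_eq_zero hn η (j := outer hn ⟨0, hpos⟩) h)⟩
  obtain ⟨u, S, hT, hS0, hS1, hcard⟩ : ∃ (u : Fin n → Fin 2) (S : Fin 2 → ℂ),
      (∀ w, (splitSpider n hn).tensor η w =
        ∑ c, S c * ∏ p, if w p = c + u p then 1 else 0) ∧ S 0 ≠ 0 ∧
      (S 1 = S 0 ∨ S 1 = -S 0 ∧ 1 ≤ errorWeight η) ∧
      (Finset.univ.filter fun p => u p = 1).card ≤ errorWeight η := by
    have hT := splitSpider_tensor_eq_sum hn hpos η k hk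
    obtain ⟨hS0, hS1⟩ := prod_edgeSign η fun e => edgeShift η (e.1, 0)
    rcases exists_card_le hn η k hk with hcard | hcard
    · exact ⟨_, _, hT, hS0, hS1, hcard⟩
    -- Passing to the complementary set of legs swaps the two global labellings, and with them their
    -- signs.
    · have key : ∀ a : Fin 2, 1 + (a + 1) = 0 + a ∧ 0 + (a + 1) = 1 + a := by decide
      refine ⟨_, fun c => ∏ e, edgeSign η e (c + (edgeShift η (e.1, 0) + 1)),
        fun w => ?_, ?_, ?_, hcard⟩
      · simp only [hT, Fin.sum_univ_two, key]
        exact add_comm _ _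
      · simp only [key]
        rcases hS1 with h | h
        · rwa [h]
        · rw [h.1]
          exact neg_ne_zero.2 hS0
      · simp only [key]
        rcases hS1 with h | h
        · exact .inl h.symm
        · exact .inr ⟨by rw [h.1, neg_neg], h.2⟩
  refine ⟨Finset.univ.filter fun p => u p = 1, S 0, hS0, ?_⟩
  rcases hS1 with h1 | ⟨h1, hW⟩
  · refine .inl ⟨hcard, fun w => ?_⟩
    rw [hT, ← sum_shift_eq_ghz, Fin.sum_univ_two, Fin.sum_univ_two, h1, mul_add]
  · right
    -- A leg that already carries an `X` takes the `Z` at no cost; if there is none, the weight of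
    -- the internal `Z` flip pays for one leg.
    obtain ⟨q, hq⟩ : ∃ q, (insert q (Finset.univ.filter fun p => u p = 1)).card ≤
        errorWeight η := by
      rcases (Finset.univ.filter fun p => u p = 1).eq_empty_or_nonempty with he | ⟨q, hq⟩
      · exact ⟨⟨0, hpos⟩, by rw [he]; simpa using hW⟩
      · exact ⟨q, by rwa [Finset.insert_eq_of_mem hq]⟩
    refine ⟨q, hq, fun w => ?_⟩
    rw [← sum_signed_shift_eq_ghz, hT, Fin.sum_univ_two, h1]
    ring

/-- Splitting a Z-spider does not change its tensor, up to a scalar. -/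
theorem splitSpider_tensor_empty (hn : Even n) :
    ∃ c : ℂ, c ≠ 0 ∧ (splitSpider n hn).tensor ∅ = c • ghz n := by
  rcases n.eq_zero_or_pos with rfl | hpos
  -- For `n = 0` there are two isolated inner spiders, with value `2 * 2`, against the single value
  -- 2 of `ghz 0`.
  · refine ⟨2, two_ne_zero, funext fun w => ?_⟩
    have : IsEmpty (Fin (0 / 2)) := inferInstanceAs (IsEmpty (Fin 0))
    refine (splitSpider_tensor hn ∅ w).trans ?_
    simp [ghz]
    norm_num
  · refine ⟨1, one_ne_zero, funext fun w => ?_⟩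
    refine (splitSpider_tensor_eq_sum hn hpos ∅ 0 (by simp [edgeShift]) w).trans ?_
    simp [edgeShift, edgeSign, ghz]

/-! ### Comparison of the distances. -/

namespace Diagram

variable {B P : Type}

theorem contract_smul (C : Diagram (B ⊕ P)) (ε : C.Error) (c : ℂ) (T : (P → Fin 2) → ℂ) :
    C.contract ε (c • T) = c • C.contract ε T := by
  classical
  funext y
  simp only [contract, Pi.smul_apply, smul_eq_mul, Finset.mul_sum, mul_ite, mul_zero]
  refine Finset.sum_congr rfl fun x _ => ite_congr rfl (fun _ => ?_) fun _ => rfl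
  ring

theorem contract_zero (C : Diagram (B ⊕ P)) (ε : C.Error) : C.contract ε 0 = 0 := by
  simpa using C.contract_smul ε 0 0

/-- If every undetectable error of `D'` is matched by an error of `D` of at most the same weight,
the distance of `D` is at most that of `D'`. -/
theorem distance_le_of_forall_error {D D' : Diagram B} (h₀ : SameUpToScalar D.interp D'.interp)
    (h : ∀ ε' : D'.Error, ¬ D'.IsDetectable ε' → ∃ ε : D.Error, D.weight ε ≤ D'.weight ε' ∧
      SameUpToScalar (D.interpError ε) (D'.interpError ε')) :
    D.distance ≤ D'.distance := by
  refine le_iInf fun ε' => le_iInf fun ht => le_iInf fun hd => ?_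
  obtain ⟨ε, hw, c, hc, hε⟩ := h ε' hd
  obtain ⟨c₀, hc₀, h₀⟩ := h₀
  refine (iInf_le_of_le ε (iInf₂_le (α := ℕ∞) ?_ ?_)).trans
    (Nat.cast_le.2 hw)
  · rintro ⟨a, ha, hεa⟩
    refine ht ⟨c⁻¹ * a * c₀, by positivity, ?_⟩
    rw [← smul_smul, ← smul_smul, ← h₀, ← hεa, hε, smul_smul, inv_mul_cancel₀ hc, one_smul]
  · intro hz
    refine hd ?_
    rw [IsDetectable, hε] at hz
    exact (smul_eq_zero.1 hz).resolve_left hc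

end Diagram

theorem SameUpToScalar.symm {Y : Type} {f g : Y → ℂ} (h : SameUpToScalar f g) :
    SameUpToScalar g f := by
  obtain ⟨c, hc, rfl⟩ := h
  exact ⟨c⁻¹, inv_ne_zero hc, by rw [smul_smul, inv_mul_cancel₀ hc, one_smul]⟩

variable {B : Type}

theorem zSpider_tensor_eq_ghz (η : Finset ((zSpider n).E × Flip)) :
    (zSpider n).tensor η = ghz n :=
  funext fun w => zSpider_tensor n η w

theorem SameUpToScalar.trans {Y : Type} {f g h : Y → ℂ} (hfg : SameUpToScalar f g)
    (hgh : SameUpToScalar g h) : SameUpToScalar f h := by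
  obtain ⟨c, hc, rfl⟩ := hfg
  obtain ⟨d, hd, rfl⟩ := hgh
  exact ⟨c * d, mul_ne_zero hc hd, smul_smul c d h⟩

theorem sameUpToScalar_interp (hn : Even n) :
    SameUpToScalar (zSpider n).toDiagram.interp (splitSpider n hn).toDiagram.interp := by
  obtain ⟨c, hc, h⟩ := splitSpider_tensor_empty hn
  refine SameUpToScalar.symm ⟨c, hc, ?_⟩
  funext y
  simp only [Pattern.interp_toDiagram, zSpider_tensor_eq_ghz, h, Pi.smul_apply]

theorem interpError_plug_zSpider (C : Diagram (B ⊕ Fin n))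
    (ε : Finset ((C.E ⊕ (zSpider n).E) × Flip)) :
    (C.plug (zSpider n)).interpError ε = C.contract (errorLeft ε) (ghz n) := by
  funext y
  rw [interpError_plug, zSpider_tensor_eq_ghz]

/-- Splitting a Z-spider whose edges carry no flips does not change the interpretation. -/
theorem sameUpToScalar_contract_splitSpider (hn : Even n) (C : Diagram (B ⊕ Fin n))
    (ε : Finset ((C.E ⊕ (splitSpider n hn).E) × Flip)) (hε : errorRight ε = ∅) :
    SameUpToScalar ((C.plug (splitSpider n hn)).interpError ε)
      (C.contract (errorLeft ε) (ghz n)) := by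
  obtain ⟨c, hc, h⟩ := splitSpider_tensor_empty hn
  refine ⟨c, hc, ?_⟩
  rw [← contract_smul, ← h, ← hε]
  exact funext fun y => interpError_plug C _ ε y

open Classical in
/-- An error of the context, as an error of the diagram with a pattern plugged in. -/
noncomputable def liftError {E : Type} (E' : Type) (ε : Finset (E × Flip)) :
    Finset ((E ⊕ E') × Flip) :=
  ε.image (Prod.map Sum.inl id)

theorem errorLeft_liftError {E : Type} (E' : Type) (ε : Finset (E × Flip)) :
    errorLeft (liftError E' ε) = ε := by
  ext ⟨e, t⟩
  simp [errorLeft, liftError]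

theorem errorRight_liftError {E : Type} (E' : Type) (ε : Finset (E × Flip)) :
    errorRight (liftError E' ε) = ∅ := by
  ext ⟨e, t⟩
  simp [errorRight, liftError]

theorem weight_liftError {P : Type} (C : Diagram (B ⊕ P)) (D : Pattern P) (ε : C.Error) :
    (C.plug D).weight (liftError D.E ε) = errorWeight ε := by
  rw [weight_plug, errorLeft_liftError, errorRight_liftError]
  simp [errorWeight]

theorem errorLeft_empty (E E' : Type) : errorLeft (∅ : Finset ((E ⊕ E') × Flip)) = ∅ := by
  simp [errorLeft]

theorem errorRight_empty (E E' : Type) : errorRight (∅ : Finset ((E ⊕ E') × Flip)) = ∅ := by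
  simp [errorRight]

theorem sameUpToScalar_plug (hn : Even n) (C : Diagram (B ⊕ Fin n)) :
    SameUpToScalar (C.plug (splitSpider n hn)).interp (C.plug (zSpider n)).interp := by
  have h := sameUpToScalar_contract_splitSpider hn C ∅ (errorRight_empty _ _)
  rw [errorLeft_empty] at h
  have h' := interpError_plug_zSpider C ∅
  rw [errorLeft_empty] at h'
  rw [← h'] at h
  exact h

/-- The easy direction: the flips on the context are kept, with none inside the split spider. -/
theorem distance_plug_splitSpider_le (hn : Even n) (C : Diagram (B ⊕ Fin n)) :
    (C.plug (splitSpider n hn)).distance ≤ (C.plug (zSpider n)).distance := by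
  refine distance_le_of_forall_error (sameUpToScalar_plug hn C) fun ε' _ =>
    ⟨liftError _ (errorLeft (E := C.E) (E' := (zSpider n).E) ε'), ?_, ?_⟩
  · rw [weight_liftError]
    exact (Nat.le_add_right _ _).trans_eq (weight_plug C (zSpider n) ε').symm
  · have h := sameUpToScalar_contract_splitSpider hn C
      (liftError _ (errorLeft (E := C.E) (E' := (zSpider n).E) ε')) (errorRight_liftError _ _)
    rw [errorLeft_liftError, ← interpError_plug_zSpider C ε'] at h
    exact h

/-- Flips inside the split spider are matched by flips on the edges of the context. -/
theorem exists_error_contract (hn : Even n) (C : Diagram (B ⊕ Fin n)) (ε : C.Error)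
    (η : Finset ((Fin (n / 2) × Fin 2) × Flip)) (h0 : (splitSpider n hn).tensor η ≠ 0) :
    ∃ ε' : C.Error, errorWeight ε' ≤ errorWeight ε + errorWeight η ∧
      SameUpToScalar (C.contract ε' (ghz n)) (C.contract ε ((splitSpider n hn).tensor η)) := by
  classical
  -- Ports that share an edge of the context only lower the weight.
  have hcard {ε' : C.Error} {Q : Finset (Fin n)}
      (hsub : ε'.image Prod.fst ⊆ ε.image Prod.fst ∪ Q.image (fun p => (C.port p).1))
      (hQ : Q.card ≤ errorWeight η) : errorWeight ε' ≤ errorWeight ε + errorWeight η :=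
    (Finset.card_le_card hsub).trans ((Finset.card_union_le _ _).trans
      (Nat.add_le_add_left (Finset.card_image_le.trans hQ) _))
  rcases n.eq_zero_or_pos with rfl | hpos
  · obtain rfl : η = ∅ := Finset.eq_empty_of_forall_notMem fun e _ => Fin.elim0 e.1.1
    obtain ⟨c, hc, h⟩ := splitSpider_tensor_empty hn
    refine ⟨ε, Nat.le_add_right _ _, SameUpToScalar.symm ⟨c, hc, ?_⟩⟩
    rw [← contract_smul, ← h]
    rfl
  obtain ⟨Q, c, hc, ⟨hQ, hT⟩ | ⟨q, hQ, hT⟩⟩ := splitSpider_tensor_flips hn hpos η h0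
  · obtain ⟨ε', hsub, d, hd, h⟩ := C.contract_flips ε Q
    refine ⟨ε', hcard hsub hQ, SameUpToScalar.trans ⟨d, hd, h _⟩
      (SameUpToScalar.symm ⟨c, hc, ?_⟩)⟩
    rw [← contract_smul]
    exact congrArg _ (funext hT)
  · obtain ⟨ε', hsub, d, hd, h⟩ := C.contract_flips ε Q
    obtain ⟨d', hd', h'⟩ := C.contract_toggle_Z ε' q
    refine ⟨_, hcard (Q := insert q Q) ((image_fst_toggle_subset _ _ _).trans ?_) hQ,
      SameUpToScalar.trans ⟨d', hd', h' _⟩ (SameUpToScalar.trans ⟨d, hd, h _⟩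
        (SameUpToScalar.symm ⟨c, hc, ?_⟩))⟩
    · rw [Finset.image_insert, Finset.union_insert]
      exact Finset.insert_subset_insert _ hsub
    · rw [← contract_smul]
      exact congrArg _ (funext hT)

/-- The hard direction. Undetectability excludes a vanishing tensor of the split spider, hence
unequal parities on its cycles. -/
theorem distance_plug_zSpider_le (hn : Even n) (C : Diagram (B ⊕ Fin n)) :
    (C.plug (zSpider n)).distance ≤ (C.plug (splitSpider n hn)).distance := by
  refine distance_le_of_forall_error (sameUpToScalar_plug hn C).symm fun ε' hε' => ?_
  have hplug : (C.plug (splitSpider n hn)).interpError ε' =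
      C.contract (errorLeft (E := C.E) (E' := (splitSpider n hn).E) ε')
        ((splitSpider n hn).tensor (errorRight (E := C.E) (E' := (splitSpider n hn).E) ε')) :=
    funext fun y => interpError_plug C _ ε' y
  obtain ⟨ε, hw, h⟩ := exists_error_contract hn C
    (errorLeft (E := C.E) (E' := (splitSpider n hn).E) ε')
    (errorRight (E := C.E) (E' := (splitSpider n hn).E) ε') fun h0 => hε' (by
      rw [IsDetectable, hplug]
      exact (congrArg _ h0).trans (C.contract_zero _))
  refine ⟨liftError _ ε, ?_, ?_⟩
  · rw [weight_liftError]
    exact hw.trans_eq (weight_plug C (splitSpider n hn) ε').symm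
  · rw [hplug]
    have h' := interpError_plug_zSpider C (liftError _ ε)
    rw [errorLeft_liftError] at h'
    rw [← h'] at h
    exact h

end ZX

theorem mainTheorem3 (n : ℕ) (hn : Even n) :
    ZX.Pattern.DistancePreserving (ZX.zSpider n) (ZX.splitSpider n hn) :=
  ⟨⟨ZX.sameUpToScalar_interp hn, fun _ C => ZX.distance_plug_zSpider_le hn C⟩,
    ⟨(ZX.sameUpToScalar_interp hn).symm, fun _ C => ZX.distance_plug_splitSpider_le hn C⟩⟩
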